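/- Let $d\ge 2$ and $\alpha\in(0,2]$. Let $X$ be the $d$-dimensional spherically symmetric $\alpha$-stable process, i.e. the Lévy process with $\mathbb E_x[e^{i\xi\cdot(X_t-x)}]=e^{-t|\xi|^\alpha}$ when started at $x$ (for $\alpha=2$, Brownian motion run at twice the standard speed), and let $-(-\Delta)^{\alpha/2}$ denote its generator ($\Delta$ if $\alpha=2$). For $\mathcal D\subset\mathbb R^d$ let $\tau(\mathcal D)=\inf\{t>0: X_t\notin\mathcal D\}$ be the exit time from $\mathcal D$, and let the inradius of $\mathcal D$ be the supremum of the radii of balls contained in $\overline{\mathcal D}$. There is a constant $c>0$, depending only on $d$ and $\alpha$, such that the following holds for every bounded convex set $\mathcal D\subset\mathbb R^d$ with non-empty interior and every bounded measurable $V:\mathcal D\to\mathbb R$. Consider the equation $$-(-\Delta)^{\alpha/2}u+Vu=0\ \text{ in }\mathcal D,\qquad u=0\ \text{ in }\mathcal D^c \quad(\text{for }\alpha=2:\ u=0\text{ on }\partial\mathcal D).\tag{E}$$ By a solution of (E) we mean a bounded continuous function $u:\mathbb R^d\to\mathbb R$ that satisfies (E), the equation being understood in the sense of distributions in the interior of $\mathcal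 D$, and that has the Feynman–Kac representation $$u(x)=\mathbb E_x\Bigl[e^{\int_0^{t\wedge\tau(\mathcal D)}V(X_s)\,ds}\,u\bigl(X_{t\wedge\tau(\mathcal D)}\bigr)\Bigr]\qquad\text{for all }x\in\mathcal D,\ t>0.$$ It is called non-zero if it does not vanish identically on $\mathcal D$. (i) If $u$ is a non-zero solution of (E) and $x_0\in\mathcal D$ is a point where $|u|$ attains its maximum over $\mathcal D$, then $$\operatorname{dist}(x_0,\partial\mathcal D)\ \ge\ c\,\Bigl(\sup_{x\in\mathcal D}|V(x)|\Bigr)^{-1/\alpha},$$ where the right-hand side is $+\infty$ if $V=0$ on $\mathcal D$ (so that in this case there is no non-zero solution). (ii) With the same constant $c$, if $$\sup_{x\in\mathcal D}|V(x)|<\Bigl[\frac{c}{\operatorname{inradius}(\mathcal D)}\Bigr]^\alpha,$$ then (E) has no non-zero solution. -/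

import Mathlib

open MeasureTheory ProbabilityTheory Filter Topology Set
open scoped NNReal ENNReal BoundedContinuousFunction Laplacian

noncomputable section

/-- `d`-dimensional Euclidean space. -/
abbrev Space (d : ℕ) : Type := EuclideanSpace ℝ (Fin d)

/-- The isotropic (spherically symmetric) `α`-stable Lévy process on `ℝᵈ` started at the origin,
`0 < α ≤ 2`: independent increments, `X_t - X_s` has characteristic function
`ξ ↦ exp (-(t - s) |ξ|^α)`, and càdlàg paths. For `α = 2` this is Brownian motion run at twice
the standard speed, with continuous paths. The process started at `x` is `t ↦ x + X_t`. -/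
structure IsStableProcess {d : ℕ} {Ω : Type*} [MeasurableSpace Ω] (α : ℝ)
    (X : ℝ≥0 → Ω → Space d) (P : Measure Ω) : Prop where
  measurable : ∀ t, Measurable (X t)
  start_zero : ∀ᵐ ω ∂P, X 0 ω = 0
  indep_increments : HasIndepIncrements X P
  charFun_increment : ∀ s t : ℝ≥0, s ≤ t → ∀ ξ : Space d,
    charFun (P.map (fun ω => X t ω - X s ω)) ξ
      = Complex.exp (-(((t : ℝ) - (s : ℝ)) * ‖ξ‖ ^ α : ℝ))
  cadlag : ∀ᵐ ω ∂P, ∀ t : ℝ≥0,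
    ContinuousWithinAt (fun s => X s ω) (Ici t) t ∧
      ∃ l : Space d, Tendsto (fun s => X s ω) (𝓝[<] t) (𝓝 l)
  continuous_paths : α = 2 → ∀ᵐ ω ∂P, Continuous (fun s => X s ω)

/-- The normalizing constant `c_{d,α}` of the fractional Laplacian, `0 < α < 2`, for which
`(-Δ)^{α/2}` has Fourier symbol `|ξ|^α`. -/
def fracLaplacianConst (d : ℕ) (α : ℝ) : ℝ :=
  α * 2 ^ (α - 1) * Real.Gamma ((d + α) / 2) / (Real.pi ^ ((d : ℝ) / 2) * Real.Gamma (1 - α / 2))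

open Classical in
/-- The operator `-(-Δ)^{α/2}` (the generator of the `α`-stable process) on smooth functions:
the Laplacian for `α = 2`, and the singular integral operator for `0 < α < 2`. -/
def stableGenerator {d : ℕ} (α : ℝ) (φ : Space d → ℝ) (x : Space d) : ℝ :=
  if α = 2 then (Δ φ) x
  else fracLaplacianConst d α *
    ∫ y : Space d, (φ (x + y) - φ x - (if ‖y‖ ≤ 1 then fderiv ℝ φ x y else 0))
      / ‖y‖ ^ ((d : ℝ) + α)

/-- `u` solves `-(-Δ)^{α/2} u + V u = 0` in `D` in the sense of distributions, with `u = 0` on the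
complement of `D` (if `α < 2`), respectively on the boundary of `D` (if `α = 2`). The values of `V`
outside `D` play no role. -/
structure IsSchrodingerSolution {d : ℕ} (α : ℝ) (D : Set (Space d)) (V : Space d → ℝ)
    (u : Space d →ᵇ ℝ) : Prop where
  equation : ∀ φ : Space d → ℝ, ContDiff ℝ (⊤ : ℕ∞) φ → HasCompactSupport φ → tsupport φ ⊆ interior D →
    (∫ x, u x * stableGenerator α φ x) + ∫ x in D, V x * u x * φ x = 0
  eq_zero_compl : α < 2 → ∀ x, x ∉ D → u x = 0
  eq_zero_frontier : α = 2 → ∀ x ∈ frontier D, u x = 0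

/-- The exit time `τ(A) = inf {t > 0 : Y_t ∉ A}` of a path `Y`, with value `∞` if `Y` stays
in `A`. -/
def exitTime {d : ℕ} (Y : ℝ≥0 → Space d) (A : Set (Space d)) : ℝ≥0∞ :=
  ⨅ (t : ℝ≥0) (_ : 0 < t) (_ : Y t ∉ A), (t : ℝ≥0∞)

/-- The time `t ∧ τ(A)`, which is finite. -/
def stoppedTime {d : ℕ} (Y : ℝ≥0 → Space d) (A : Set (Space d)) (t : ℝ≥0) : ℝ≥0 :=
  (min (t : ℝ≥0∞) (exitTime Y A)).toNNReal

/-- The Feynman-Kac representation in `D`: for all `x ∈ D` and `t > 0`,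
`u(x) = 𝔼_x [exp (∫₀^{t ∧ τ(D)} V(X_s) ds) u(X_{t ∧ τ(D)})]`. -/
def HasFeynmanKac {d : ℕ} {Ω : Type*} [MeasurableSpace Ω] (X : ℝ≥0 → Ω → Space d) (P : Measure Ω)
    (D : Set (Space d)) (V : Space d → ℝ) (u : Space d →ᵇ ℝ) : Prop :=
  ∀ x ∈ D, ∀ t : ℝ≥0, 0 < t →
    u x = ∫ ω,
      Real.exp (∫ s in (0 : ℝ)..(stoppedTime (fun r => x + X r ω) D t : ℝ),
          V (x + X s.toNNReal ω))
        * u (x + X (stoppedTime (fun r => x + X r ω) D t) ω) ∂P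

/-- `sup_{x ∈ D} |V x|`, as an extended nonnegative real. -/
def supAbs {d : ℕ} (D : Set (Space d)) (V : Space d → ℝ) : ℝ≥0∞ :=
  ⨆ x ∈ D, ENNReal.ofReal |V x|

/-- The inradius: the supremum of the radii of the balls contained in the closure of `D`. -/
def inradius {d : ℕ} (D : Set (Space d)) : ℝ≥0∞ :=
  ⨆ (r : ℝ≥0) (x : Space d) (_ : Metric.closedBall x (r : ℝ) ⊆ closure D), (r : ℝ≥0∞)

end

/-! Let `|u|` be maximal at `x₀`, with a boundary point `y` within `δ` of `x₀`. Convexity puts `D`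
in a half-space bounded by a hyperplane through `y`. By time `t = (2δ)^α`, the natural time scale
for distance `2δ`, the process has left this half-space, hence `D`, with probability at least `1/8`
(`IsStableProcess.one_div_eight_le_halfSpace`). Paths that exit contribute nothing to Feynman–Kac,
since `u` vanishes where they exit, so `|u x₀| ≤ (7/8) exp (t M) |u x₀|` with `M` bounding `|V|`.
Thus `t M ≥ log (8/7)` (`log_le_of_isMaxOn`), which is (i). Part (ii) follows because the distance
to the boundary is at most the inradius. -/

/-- A symmetric law whose characteristic function at `w` equals `e⁻¹` charges the half-space
`{⟪x, w⟫ > 1/2}` with mass at least `1/8`. -/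
theorem one_div_eight_le_real_halfSpace {d : ℕ} (ν : Measure (Space d)) [IsProbabilityMeasure ν]
    (w : Space d) (hw : charFun ν w = Complex.exp (-1 : ℝ))
    (hsymm : ∀ ξ, charFun ν (-ξ) = charFun ν ξ) :
    1 / 8 ≤ ν.real {x | 1 / 2 < inner ℝ x w} := by
  have hmeas : Measurable fun x : Space d => inner ℝ x w := by fun_prop
  have hA : MeasurableSet {x : Space d | 1 / 2 < inner ℝ x w} :=
    measurableSet_lt measurable_const hmeas
  have hB : MeasurableSet {x : Space d | inner ℝ x w < -(1 / 2)} :=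
    measurableSet_lt hmeas measurable_const
  have hneg : ν.map (fun x => -x) = ν := by
    have : IsProbabilityMeasure (ν.map (fun x => -x)) :=
      Measure.isProbabilityMeasure_map measurable_neg.aemeasurable
    refine Measure.ext_of_charFun ?_
    ext ξ
    rw [← hsymm ξ, charFun_apply, charFun_apply,
      integral_map measurable_neg.aemeasurable (by fun_prop)]
    simp
  have hAB : ν.real {x | inner ℝ x w < -(1 / 2)} = ν.real {x | 1 / 2 < inner ℝ x w} := by
    conv_lhs => rw [← hneg]
    rw [map_measureReal_apply measurable_neg hB]
    congr 1
    ext x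
    simp only [mem_preimage, mem_ofPred_eq, inner_neg_left]
    constructor <;> intro h <;> linarith
  have hcos : ∫ x, Real.cos (inner ℝ x w) ∂ν = Real.exp (-1) := by
    have h := congrArg Complex.re hw
    rw [charFun_apply, ← Complex.ofReal_exp, Complex.ofReal_re] at h
    rw [← h]
    have hi : Integrable (fun x : Space d => Complex.exp (inner ℝ x w * Complex.I)) ν := by
      refine Integrable.of_bound (by fun_prop) 1 (ae_of_all _ fun x => ?_)
      simp [Complex.norm_exp_ofReal_mul_I]
    have h2 := integral_re hi
    simp only [RCLike.re_eq_complex_re] at h2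
    rw [← h2]
    simp [Complex.exp_ofReal_mul_I_re]
  -- For `|s| ≤ 1/2`, `cos s ≥ 1 - s²/2 ≥ 7/8`; elsewhere `cos s ≥ -1`. With `p` the mass of either
  -- tail, integrating gives `e⁻¹ ≥ 7/8 - 4p`, hence `p > 1/8`.
  have hbound : ∀ x : Space d, 7 / 8 -
      (2 * indicator {x : Space d | 1 / 2 < inner ℝ x w} 1 x
        + 2 * indicator {x : Space d | inner ℝ x w < -(1 / 2)} 1 x) ≤ Real.cos (inner ℝ x w) := by
    intro x
    have h1 := Real.neg_one_le_cos (inner ℝ x w)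
    have h2 := Real.one_sub_sq_div_two_le_cos (x := inner ℝ x w)
    by_cases ha : 1 / 2 < inner ℝ x w <;> by_cases hb : inner ℝ x w < -(1 / 2) <;>
      simp only [indicator, mem_ofPred_eq, ha, hb, if_true, if_false, Pi.one_apply] <;> nlinarith
  have hiA : Integrable (fun x => 2 * indicator {x : Space d | 1 / 2 < inner ℝ x w}
      (1 : Space d → ℝ) x) ν :=
    ((integrable_const (1 : ℝ)).indicator hA).const_mul 2
  have hiB : Integrable (fun x => 2 * indicator {x : Space d | inner ℝ x w < -(1 / 2)}
      (1 : Space d → ℝ) x) ν :=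
    ((integrable_const (1 : ℝ)).indicator hB).const_mul 2
  have hmono := integral_mono ((integrable_const (7 / 8 : ℝ)).sub (hiA.add hiB))
    (Integrable.of_bound (C := 1) (by fun_prop)
      (ae_of_all _ fun x => by simpa using Real.abs_cos_le_one (inner ℝ x w))) hbound
  have hcalc := integral_sub (integrable_const (7 / 8 : ℝ)) (hiA.add hiB)
  simp only [Pi.add_apply] at hcalc
  rw [integral_add hiA hiB, integral_const_mul, integral_const_mul, integral_indicator_one hA,
    integral_indicator_one hB, hAB] at hcalc
  simp only [Pi.sub_apply, Pi.add_apply] at hmono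
  rw [hcalc, hcos] at hmono
  simp only [integral_const, probReal_univ, one_smul] at hmono
  have := Real.exp_neg_one_lt_d9
  linarith

/-! ### Exit times and vanishing at exit -/

theorem mem_of_lt_exitTime {d : ℕ} {Y : ℝ≥0 → Space d} {A : Set (Space d)} {s : ℝ≥0}
    (hs : 0 < s) (h : (s : ℝ≥0∞) < exitTime Y A) : Y s ∈ A := by
  by_contra hY
  exact absurd h (not_lt.mpr (iInf_le_of_le s (iInf_le_of_le hs (iInf_le_of_le hY le_rfl))))

/-- The infimum need not be attained, but there are times outside `A` at `τ` or arbitrarily soon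
after it; right continuity passes to the limit. -/
theorem mem_closure_compl_of_exitTime {d : ℕ} {Y : ℝ≥0 → Space d} {A : Set (Space d)} {τ : ℝ≥0}
    (hY : ContinuousWithinAt Y (Ici τ) τ) (h : exitTime Y A = τ) : Y τ ∈ closure Aᶜ := by
  refine mem_closure_of_frequently_of_tendsto (b := 𝓝[≥] τ) ?_ hY
  intro hev
  rw [Filter.Eventually, mem_nhdsGE_iff_exists_Ico_subset] at hev
  obtain ⟨b, hb, hsub⟩ := hev
  have hlt : exitTime Y A < b := by rw [h]; exact_mod_cast hb
  simp only [exitTime, iInf_lt_iff] at hlt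
  obtain ⟨s, hs, hsA, hsb⟩ := hlt
  have hτs : (τ : ℝ≥0∞) ≤ s := by
    rw [← h]
    exact iInf_le_of_le s (iInf_le_of_le hs (iInf_le_of_le hsA le_rfl))
  exact hsub ⟨by exact_mod_cast hτs, by exact_mod_cast hsb⟩ hsA

theorem mem_closure_of_exitTime {d : ℕ} {Y : ℝ≥0 → Space d} {A : Set (Space d)} {τ : ℝ≥0}
    (hY : Continuous Y) (h0 : Y 0 ∈ A) (h : exitTime Y A = τ) : Y τ ∈ closure A := by
  rcases eq_or_ne τ 0 with rfl | hτ
  · exact subset_closure h0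
  have hpos : 0 < τ := pos_iff_ne_zero.mpr hτ
  have : (𝓝[<] τ).NeBot := nhdsLT_neBot_of_exists_lt ⟨0, hpos⟩
  refine mem_closure_of_tendsto (b := 𝓝[<] τ) (hY.continuousAt.mono_left nhdsWithin_le_nhds) ?_
  filter_upwards [Ioo_mem_nhdsLT hpos] with s hs
  refine mem_of_lt_exitTime hs.1 ?_
  rw [h]
  exact_mod_cast hs.2

theorem IsSchrodingerSolution.eq_zero_of_mem_frontier {d : ℕ} {α : ℝ} {D : Set (Space d)}
    {V : Space d → ℝ} {u : Space d →ᵇ ℝ} (hu : IsSchrodingerSolution α D V u) (hα : α ≤ 2)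
    {x : Space d} (hx : x ∈ frontier D) : u x = 0 := by
  rcases hα.lt_or_eq with h | h
  · rw [frontier_eq_closure_inter_closure] at hx
    exact closure_minimal (fun y hy => hu.eq_zero_compl h y hy)
      (isClosed_eq u.continuous continuous_const) hx.2
  · exact hu.eq_zero_frontier h x hx

/-- For `α < 2` the path may jump over the boundary, but `u` vanishes on all of `closure Dᶜ` by
continuity. For `α = 2` only the frontier is known to carry zeros, so path continuity is needed to
place the exit point there. -/
theorem IsSchrodingerSolution.eq_zero_at_exit {d : ℕ} {α : ℝ} {D : Set (Space d)}
    {V : Space d → ℝ} {u : Space d →ᵇ ℝ} (hu : IsSchrodingerSolution α D V u) (hα : α ≤ 2)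
    {Y : ℝ≥0 → Space d} (h0 : Y 0 ∈ D) {τ : ℝ≥0} (hY : ContinuousWithinAt Y (Ici τ) τ)
    (hc : α = 2 → Continuous Y) (h : exitTime Y D = τ) : u (Y τ) = 0 := by
  have hcl := mem_closure_compl_of_exitTime hY h
  rcases hα.lt_or_eq with h2 | h2
  · exact closure_minimal (fun y hy => hu.eq_zero_compl h2 y hy)
      (isClosed_eq u.continuous continuous_const) hcl
  · refine hu.eq_zero_frontier h2 _ ?_
    rw [frontier_eq_closure_inter_closure]
    exact ⟨mem_closure_of_exitTime (hc h2) h0 h, hcl⟩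

/-! ### Leaving a supporting half-space -/

/-- Hahn–Banach separates `y` from the open set `interior D`, strictly, so the normal is nonzero;
`D` lies in the closure of its interior. -/
theorem exists_supporting_halfSpace {d : ℕ} {D : Set (Space d)} (hconv : Convex ℝ D)
    (hint : (interior D).Nonempty) {y : Space d} (hy : y ∈ frontier D) :
    ∃ v : Space d, v ≠ 0 ∧ ∀ z ∈ D, inner ℝ z v ≤ inner ℝ y v := by
  obtain ⟨f, hf⟩ := geometric_hahn_banach_open_point hconv.interior isOpen_interior hy.2
  have hfv : ∀ z, f z = inner ℝ z ((InnerProductSpace.toDual ℝ (Space d)).symm f) := by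
    intro z
    rw [real_inner_comm, InnerProductSpace.toDual_symm_apply]
  refine ⟨(InnerProductSpace.toDual ℝ (Space d)).symm f, ?_, fun z hz => ?_⟩
  · intro hv
    obtain ⟨a, ha⟩ := hint
    have := hf a ha
    rw [hfv, hfv, hv] at this
    simp at this
  · rw [← hfv, ← hfv]
    have hz' : z ∈ closure (interior D) := by
      rw [hconv.closure_interior_eq_closure_of_nonempty_interior hint]
      exact subset_closure hz
    exact closure_minimal (fun a ha => (hf a ha).le)
      (isClosed_le f.continuous continuous_const) hz'

theorem IsStableProcess.one_div_eight_le_halfSpace {d : ℕ} {Ω : Type*} [MeasurableSpace Ω] {α : ℝ}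
    {X : ℝ≥0 → Ω → Space d} {P : Measure Ω} [IsProbabilityMeasure P]
    (hX : IsStableProcess α X P) {t : ℝ≥0} {w : Space d} (htw : (t : ℝ) * ‖w‖ ^ α = 1) :
    1 / 8 ≤ P.real {ω | 1 / 2 < inner ℝ (X t ω) w} := by
  have hlaw : P.map (fun ω => X t ω - X 0 ω) = P.map (X t) := by
    refine Measure.map_congr ?_
    filter_upwards [hX.start_zero] with ω hω
    rw [hω, sub_zero]
  have hchar := hX.charFun_increment 0 t zero_le
  rw [hlaw] at hchar
  have : IsProbabilityMeasure (P.map (X t)) :=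
    Measure.isProbabilityMeasure_map (hX.measurable t).aemeasurable
  have h := one_div_eight_le_real_halfSpace (P.map (X t)) w
    (by rw [hchar, NNReal.coe_zero, sub_zero, htw, Complex.ofReal_neg]) (fun ξ => by rw [hchar, hchar, norm_neg])
  rwa [map_measureReal_apply (hX.measurable t)
    (measurableSet_lt measurable_const (by fun_prop))] at h

/-! ### The estimate at a maximum point -/

/-- The product of `sup |V|` and the `α`-th power of twice
the distance of a maximum point of `|u|` to the boundary is at least `log (8/7)`. -/
theorem log_le_of_isMaxOn {d : ℕ} {Ω : Type*} [MeasurableSpace Ω] {α : ℝ} (hα2 : α ≤ 2)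
    {X : ℝ≥0 → Ω → Space d} {P : Measure Ω} [IsProbabilityMeasure P]
    (hX : IsStableProcess α X P) {D : Set (Space d)} (hconv : Convex ℝ D)
    (hint : (interior D).Nonempty) {V : Space d → ℝ} {M : ℝ} (hV : ∀ x ∈ D, |V x| ≤ M)
    {u : Space d →ᵇ ℝ} (hu : IsSchrodingerSolution α D V u) (hFK : HasFeynmanKac X P D V u)
    {x₀ : Space d} (hx₀ : x₀ ∈ D) (hmax : IsMaxOn (fun x => |u x|) D x₀) (hne : u x₀ ≠ 0)
    {y : Space d} (hy : y ∈ frontier D) {δ : ℝ} (hδ : 0 < δ) (hyδ : dist x₀ y ≤ δ) :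
    Real.log (8 / 7) ≤ (2 * δ) ^ α * M := by
  obtain ⟨v, hv0, hv⟩ := exists_supporting_halfSpace hconv hint hy
  have hvn : 0 < ‖v‖ := norm_pos_iff.mpr hv0
  -- The normal is scaled so that `D - x₀` lies in `{⟪z, w⟫ ≤ 1/2}`; then `t = (2δ)^α` makes the
  -- characteristic function of `X t` at `w` equal to `e⁻¹`.
  set w : Space d := ((2 * δ)⁻¹ * ‖v‖⁻¹) • v with hwdef
  have hcoef : 0 < (2 * δ)⁻¹ * ‖v‖⁻¹ := by positivity
  have hwn : ‖w‖ = (2 * δ)⁻¹ := by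
    rw [hwdef, norm_smul, Real.norm_of_nonneg hcoef.le]
    field_simp
  have hw : ∀ z, x₀ + z ∈ D → inner ℝ z w ≤ 1 / 2 := by
    intro z hz
    have h1 : inner ℝ z w ≤ inner ℝ (y - x₀) w := by
      have := hv _ hz
      rw [hwdef, inner_smul_right, inner_smul_right]
      refine mul_le_mul_of_nonneg_left ?_ hcoef.le
      rw [inner_sub_left]
      rw [inner_add_left] at this
      linarith
    refine h1.trans ((real_inner_le_norm _ _).trans ?_)
    rw [hwn, ← dist_eq_norm, dist_comm]
    calc dist x₀ y * (2 * δ)⁻¹ ≤ δ * (2 * δ)⁻¹ := by gcongr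
      _ = 1 / 2 := by field_simp
  have htpos : 0 < (2 * δ) ^ α := by positivity
  set t : ℝ≥0 := ⟨(2 * δ) ^ α, htpos.le⟩ with htdef
  have ht0 : 0 < t := htpos
  have htc : (t : ℝ) = (2 * δ) ^ α := rfl
  have htw : (t : ℝ) * ‖w‖ ^ α = 1 := by
    rw [hwn, htc, Real.inv_rpow (by positivity), mul_inv_cancel₀ htpos.ne']
  have hprob := hX.one_div_eight_le_halfSpace htw
  set A : Set Ω := {ω | 1 / 2 < inner ℝ (X t ω) w} with hA
  have hAm : MeasurableSet A :=
    measurableSet_lt measurable_const ((hX.measurable t).inner measurable_const)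
  rw [← htc]
  have hM : 0 ≤ M := (abs_nonneg _).trans (hV x₀ hx₀)
  have hFKt := hFK x₀ hx₀ t ht0
  set F : Ω → ℝ := fun ω =>
      Real.exp (∫ s in (0 : ℝ)..(stoppedTime (fun r => x₀ + X r ω) D t : ℝ),
          V (x₀ + X s.toNNReal ω))
        * u (x₀ + X (stoppedTime (fun r => x₀ + X r ω) D t) ω) with hF
  have hbound : ∀ᵐ ω ∂P, ‖F ω‖ ≤ Aᶜ.indicator (fun _ => Real.exp (t * M) * |u x₀|) ω := by
    have hcp : ∀ᵐ ω ∂P, α = 2 → Continuous (fun s => X s ω) := by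
      by_cases h2 : α = 2
      · filter_upwards [hX.continuous_paths h2] with ω hω _ using hω
      · exact ae_of_all _ fun ω h => absurd h h2
    filter_upwards [hX.start_zero, hX.cadlag, hcp] with ω h0 hcad hcont
    have hnonneg : 0 ≤ Aᶜ.indicator (fun _ => Real.exp (t * M) * |u x₀|) ω :=
      indicator_nonneg (fun _ _ => by positivity) ω
    rcases le_or_gt (exitTime (fun r => x₀ + X r ω) D) (t : ℝ≥0∞) with hle | hlt
    · lift exitTime (fun r => x₀ + X r ω) D to ℝ≥0 using
        ne_top_of_le_ne_top ENNReal.coe_ne_top hle with τ hτ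
      have hst : stoppedTime (fun r => x₀ + X r ω) D t = τ := by
        rw [stoppedTime, ← hτ, min_eq_right hle, ENNReal.toNNReal_coe]
      have hz : u (x₀ + X τ ω) = 0 :=
        hu.eq_zero_at_exit hα2 (Y := fun r => x₀ + X r ω) (by simpa [h0] using hx₀)
          (continuousWithinAt_const.add (hcad τ).1)
          (fun h => continuous_const.add (hcont h)) hτ.symm
      simp only [hF, hst, hz, mul_zero, norm_zero]
      exact hnonneg
    · have hst : stoppedTime (fun r => x₀ + X r ω) D t = t := by
        rw [stoppedTime, min_eq_left hlt.le, ENNReal.toNNReal_coe]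
      -- Time `0` does not enter the exit time, and the integral over `(0, t]` does not need it.
      have hD : ∀ s : ℝ≥0, 0 < s → s ≤ t → x₀ + X s ω ∈ D := fun s hs hst =>
        mem_of_lt_exitTime (Y := fun r => x₀ + X r ω) hs
          (lt_of_le_of_lt (by exact_mod_cast hst) hlt)
      have hωA : ω ∈ Aᶜ := fun h => absurd h (not_lt.mpr (hw _ (hD t ht0 le_rfl)))
      rw [indicator_of_mem hωA]
      simp only [hF, hst, norm_mul, Real.norm_eq_abs, Real.abs_exp]
      have hI : ‖∫ s in (0 : ℝ)..(t : ℝ), V (x₀ + X s.toNNReal ω)‖ ≤ M * |(t : ℝ) - 0| := by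
        refine intervalIntegral.norm_integral_le_of_norm_le_const fun s hs => ?_
        rw [uIoc_of_le t.coe_nonneg] at hs
        exact hV _ (hD _ (Real.toNNReal_pos.mpr hs.1) (Real.toNNReal_le_iff_le_coe.mpr hs.2))
      rw [sub_zero, abs_of_nonneg t.coe_nonneg, mul_comm] at hI
      exact mul_le_mul (Real.exp_le_exp.mpr ((le_abs_self _).trans hI)) (hmax (hD t ht0 le_rfl))
        (abs_nonneg _) (Real.exp_pos _).le
  have hint' : |u x₀| ≤ P.real Aᶜ * (Real.exp (t * M) * |u x₀|) := by
    rw [← smul_eq_mul, ← integral_indicator_const _ hAm.compl]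
    conv_lhs => rw [hFKt]
    exact norm_integral_le_of_norm_le ((integrable_const _).indicator hAm.compl) hbound
  have hAc : P.real Aᶜ ≤ 7 / 8 := by
    rw [probReal_compl_eq_one_sub hAm]
    linarith
  have hupos : 0 < |u x₀| := abs_pos.mpr hne
  have hE : 1 ≤ 7 / 8 * Real.exp (t * M) := by
    have h1 : 1 * |u x₀| ≤ (7 / 8 * Real.exp (t * M)) * |u x₀| := by
      rw [one_mul, mul_assoc]
      exact hint'.trans (mul_le_mul_of_nonneg_right hAc (by positivity))
    exact le_of_mul_le_mul_right h1 hupos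
  rw [Real.log_le_iff_le_exp (by norm_num)]
  linarith

/-! ### Inradius, existence of a maximum, and conclusion -/

/-- A ball about a point of `D` that misses the frontier is connected, so it cannot leave `interior
D`. -/
theorem infEDist_frontier_le_inradius {d : ℕ} {D : Set (Space d)} {x : Space d} (hx : x ∈ D) :
    Metric.infEDist x (frontier D) ≤ inradius D := by
  refine ENNReal.le_of_forall_nnreal_lt fun r hr => ?_
  refine le_iSup_of_le r (le_iSup_of_le x (le_iSup_of_le ?_ le_rfl))
  have hconn : IsPreconnected (Metric.closedBall x (r : ℝ)) :=
    (convex_closedBall x (r : ℝ)).isPreconnected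
  have hdisj : Disjoint (Metric.closedBall x (r : ℝ)) (frontier D) := by
    rw [Set.disjoint_left]
    intro z hz hzf
    have h1 := Metric.infEDist_le_edist_of_mem (x := x) hzf
    have h2 : edist x z ≤ r := by
      rw [edist_comm, edist_nndist]
      exact_mod_cast (show nndist z x ≤ r from hz)
    exact absurd (hr.trans_le (h1.trans h2)) (lt_irrefl _)
  have hcover : Metric.closedBall x (r : ℝ) ⊆ interior D ∪ (closure D)ᶜ := fun z hz => by
    by_contra h
    rw [mem_union, not_or, notMem_compl_iff] at h
    exact Set.disjoint_left.mp hdisj hz ⟨h.2, h.1⟩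
  have hxr := Metric.mem_closedBall_self (x := x) r.coe_nonneg
  have hxint : x ∈ interior D :=
    (hcover hxr).resolve_right fun h => h (subset_closure hx)
  exact (hconn.subset_left_of_subset_union isOpen_interior isClosed_closure.isOpen_compl
    (disjoint_compl_right.mono_left (interior_subset.trans subset_closure)) hcover
    ⟨x, hxr, hxint⟩).trans (interior_subset.trans subset_closure)

/-- A maximum over the compact closure is positive, so it cannot sit on the frontier, where `u`
vanishes. -/
theorem IsSchrodingerSolution.exists_isMaxOn {d : ℕ} {α : ℝ} (hα : α ≤ 2) {D : Set (Space d)}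
    (hbdd : Bornology.IsBounded D) {V : Space d → ℝ} {u : Space d →ᵇ ℝ}
    (hu : IsSchrodingerSolution α D V u) (hne : ∃ x ∈ D, u x ≠ 0) :
    ∃ x₀ ∈ D, IsMaxOn (fun x => |u x|) D x₀ := by
  obtain ⟨a, ha, hua⟩ := hne
  obtain ⟨x₀, hx₀, hmax⟩ := hbdd.isCompact_closure.exists_isMaxOn ⟨a, subset_closure ha⟩
    (f := fun x => |u x|) (by fun_prop)
  have hpos : 0 < |u x₀| := (abs_pos.mpr hua).trans_le (hmax (subset_closure ha))
  refine ⟨x₀, ?_, hmax.on_subset subset_closure⟩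
  by_contra hx
  have hfr : x₀ ∈ frontier D := ⟨hx₀, fun h => hx (interior_subset h)⟩
  rw [hu.eq_zero_of_mem_frontier hα hfr, abs_zero] at hpos
  exact lt_irrefl _ hpos

theorem supAbs_ne_top {d : ℕ} {D : Set (Space d)} {V : Space d → ℝ} {M : ℝ}
    (hV : ∀ x ∈ D, |V x| ≤ M) : supAbs D V ≠ ∞ :=
  ne_top_of_le_ne_top ENNReal.ofReal_ne_top
    (iSup₂_le fun x hx => ENNReal.ofReal_le_ofReal (hV x hx))

theorem abs_le_toReal_supAbs {d : ℕ} {D : Set (Space d)} {V : Space d → ℝ}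
    (h : supAbs D V ≠ ∞) {x : Space d} (hx : x ∈ D) : |V x| ≤ (supAbs D V).toReal :=
  (ENNReal.ofReal_le_iff_le_toReal h).mp
    (le_iSup₂ (f := fun x (_ : x ∈ D) => ENNReal.ofReal |V x|) x hx)

theorem ofReal_mul_supAbs_rpow_le_infEDist {d : ℕ} {Ω : Type*} [MeasurableSpace Ω] {α : ℝ}
    (hα0 : 0 < α) (hα2 : α ≤ 2)
    {X : ℝ≥0 → Ω → Space d} {P : Measure Ω} [IsProbabilityMeasure P]
    (hX : IsStableProcess α X P) {D : Set (Space d)} (hconv : Convex ℝ D)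
    (hint : (interior D).Nonempty) {V : Space d → ℝ} (hV : ∃ M : ℝ, ∀ x ∈ D, |V x| ≤ M)
    {u : Space d →ᵇ ℝ} (hu : IsSchrodingerSolution α D V u) (hFK : HasFeynmanKac X P D V u)
    (hne : ∃ x ∈ D, u x ≠ 0)
    {x₀ : Space d} (hx₀ : x₀ ∈ D) (hmax : IsMaxOn (fun x => |u x|) D x₀) :
    ENNReal.ofReal (Real.log (8 / 7) ^ (1 / α) / 2) * supAbs D V ^ (-(1 / α))
      ≤ Metric.infEDist x₀ (frontier D) := by
  obtain ⟨M, hM⟩ := hV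
  have hfin := supAbs_ne_top hM
  obtain ⟨a, ha, hua⟩ := hne
  have hux : u x₀ ≠ 0 := abs_pos.mp ((abs_pos.mpr hua).trans_le (hmax ha))
  -- Working with radii `r` strictly above the distance keeps `r > 0` even if `x₀` lies on the
  -- frontier.
  refine le_of_forall_gt fun b hb => ?_
  obtain ⟨r, hr, hrb⟩ := ENNReal.lt_iff_exists_nnreal_btwn.mp hb
  refine lt_of_le_of_lt ?_ hrb
  obtain ⟨y, hy, hyr⟩ := Metric.infEDist_lt_iff.mp hr
  have hr0 : 0 < (r : ℝ) := by
    have : (0 : ℝ≥0∞) < r := pos_of_gt hr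
    exact_mod_cast this
  have hdist : dist x₀ y ≤ r := by
    rw [edist_nndist] at hyr
    exact_mod_cast hyr.le
  set S : ℝ := (supAbs D V).toReal with hS
  have hmain := log_le_of_isMaxOn hα2 hX hconv hint
    (fun x hx => abs_le_toReal_supAbs hfin hx) hu hFK hx₀ hmax hux hy hr0 hdist
  have hlog : 0 < Real.log (8 / 7) := Real.log_pos (by norm_num)
  -- If `V` vanished on `D`, the estimate would read `log (8/7) ≤ 0`.
  have hSpos : 0 < S := by
    by_contra hS0
    have : S = 0 := le_antisymm (not_lt.mp hS0) ENNReal.toReal_nonneg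
    rw [← hS, this, mul_zero] at hmain
    linarith
  rw [← ENNReal.ofReal_toReal hfin, ← hS, ENNReal.ofReal_rpow_of_pos hSpos,
    ← ENNReal.ofReal_mul (by positivity), ← ENNReal.ofReal_coe_nnreal]
  refine ENNReal.ofReal_le_ofReal ?_
  have hroot := Real.rpow_le_rpow hlog.le hmain (by positivity : 0 ≤ 1 / α)
  rw [Real.mul_rpow (by positivity) hSpos.le, ← Real.rpow_mul (by positivity),
    mul_one_div_cancel hα0.ne', Real.rpow_one] at hroot
  rw [Real.rpow_neg hSpos.le, ← div_eq_mul_inv, div_le_iff₀ (by positivity)]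
  linarith

/-- In `ℝ≥0∞` one has `0 ^ (-1/α) = ∞`: the first conclusion includes that there is no nonzero
solution when `V` vanishes on `D`. -/
theorem corollary1p1 (d : ℕ) (hd : 2 ≤ d) (α : ℝ) (hα0 : 0 < α) (hα2 : α ≤ 2) :
    ∃ c : ℝ, 0 < c ∧
      ∀ (Ω : Type*) [MeasurableSpace Ω] (P : Measure Ω) [IsProbabilityMeasure P]
        (X : ℝ≥0 → Ω → Space d), IsStableProcess α X P →
      ∀ D : Set (Space d), Bornology.IsBounded D → Convex ℝ D → (interior D).Nonempty →
      ∀ V : Space d → ℝ, AEMeasurable V (volume.restrict D) → (∃ M : ℝ, ∀ x ∈ D, |V x| ≤ M) →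
        (∀ u : Space d →ᵇ ℝ, IsSchrodingerSolution α D V u → HasFeynmanKac X P D V u →
          (∃ x ∈ D, u x ≠ 0) →
          ∀ x₀ ∈ D, IsMaxOn (fun x => |u x|) D x₀ →
            ENNReal.ofReal c * supAbs D V ^ (-(1 / α)) ≤ Metric.infEDist x₀ (frontier D)) ∧
        (supAbs D V < (ENNReal.ofReal c / inradius D) ^ α →
          ¬ ∃ u : Space d →ᵇ ℝ, IsSchrodingerSolution α D V u ∧ HasFeynmanKac X P D V u ∧
            ∃ x ∈ D, u x ≠ 0) := by
  refine ⟨Real.log (8 / 7) ^ (1 / α) / 2, ?_, ?_⟩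
  · have : 0 < Real.log (8 / 7) := Real.log_pos (by norm_num)
    positivity
  intro Ω _ P _ X hX D hbdd hconv hint V _ hV
  refine ⟨fun u hu hFK hne x₀ hx₀ hmax => ofReal_mul_supAbs_rpow_le_infEDist hα0 hα2 hX hconv hint
    hV hu hFK hne hx₀ hmax, ?_⟩
  rintro hlt ⟨u, hu, hFK, hne⟩
  obtain ⟨x₀, hx₀, hmax⟩ := hu.exists_isMaxOn hα2 hbdd hne
  have hle := (ofReal_mul_supAbs_rpow_le_infEDist hα0 hα2 hX hconv hint hV hu hFK hne hx₀
    hmax).trans (infEDist_frontier_le_inradius hx₀)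
  have hroot : supAbs D V ^ (1 / α)
      < ENNReal.ofReal (Real.log (8 / 7) ^ (1 / α) / 2) / inradius D := by
    rwa [one_div α, ENNReal.rpow_inv_lt_iff hα0, ← one_div]
  -- An infinite inradius would make the right side of `hroot` zero; finiteness permits clearing
  -- denominators below.
  have hin : inradius D ≠ ∞ := by
    intro h
    rw [h, ENNReal.div_top] at hroot
    exact not_lt_zero hroot
  refine absurd hroot (not_lt.mpr (ENNReal.div_le_of_le_mul ?_))
  rw [ENNReal.rpow_neg, ← div_eq_mul_inv,
    ENNReal.div_le_iff_le_mul (Or.inr hin) (Or.inl hroot.ne_top)] at hle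
  rwa [mul_comm]
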